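/- **Setting.** For $d\ge 1$ and $x\in\mathbb Z^d$ let $\langle x\rangle=(1+|x|^2)^{1/2}$ with the Euclidean norm $|x|$, and for $p>0$ let $$X_p=\Big\{\psi\colon\mathbb Z^d\to\mathbb C \;:\; \sup_{x\in\mathbb Z^d}\langle x\rangle^{-p}|\psi(x)|<\infty\Big\}.$$ Let $\alpha\colon\mathbb Z^d\to\mathbb R$ be symmetric ($\alpha(-x)=\alpha(x)$) with finite support, and let $\lambda>0$. The discrete nonlinear Schrödinger equation (DNLS) is $i\,\partial_t\psi_t(x)=\sum_{y}\alpha(x-y)\psi_t(y)+\lambda|\psi_t(x)|^2\psi_t(x)$. For $L\ge 0$ let $\Lambda_L=\{-L,\dots,L\}^d$ with addition modulo $2L+1$, let $V=(2L+1)^d$, and for $\psi\in\mathbb C^{\Lambda_L}$ put $$H_L(\psi)=\sum_{x,y\in\Lambda_L}\alpha(x-y)\psi(x)\overline{\psi(y)}+\frac{\lambda}{2}\sum_{x\in\Lambda_L}|\psi(x)|^4,\qquad N_L(\psi)=\sum_{x\in\Lambda_L}|\psi(x)|^2,$$ where $x-y$ is computed in $\Lambda_L$. Let $d\psi=\prod_{x\in\Lambda_L}d(\mathrm{Re}\,\psi(x))\,d(\mathrm{Im}\,\psi(x))$.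 * A *finite microcanonical measure* with energy density $\rho_E$ and particle density $\rho_N$ is a probability measure $Z^{-1}\delta(H_L-\rho_E V)\,\delta(N_L-\rho_N V)\,d\psi$ on $\mathbb C^{\Lambda_L}$, that is, a weak limit of the normalized Lebesgue measures on the shells $\{|H_L-\rho_EV|\le a_k,\ |N_L-\rho_NV|\le b_k\}$ for some sequences $a_k,b_k>0$ tending to $0$. * The *finite grand canonical Gibbs measure* with inverse temperature $\beta>0$ and chemical potential $\kappa\in\mathbb R$ is $Z^{-1}e^{-\beta(H_L-\kappa N_L)}\,d\psi$ on $\mathbb C^{\Lambda_L}$. * A probability measure $\mu$ on $\mathbb C^{\mathbb Z^d}$ (product topology and product $\sigma$-algebra) is a *microcanonical measure* (respectively a *grand canonical Gibbs measure*) of the infinite system if it is the weak limit, along some sequence $L_k\to\infty$, of the periodic extensions to $\mathbb Z^d$ of finite microcanonical measures on $\mathbb C^{\Lambda_{L_k}}$ with fixed densities $\rho_E,\rho_N$ (respectively of the finite Gibbs measures on $\mathbb C^{\Lambda_{L_k}}$ with fixed $\beta,\kappa$). Existence of such measures is not asserted. **Theorem.** Let $c>0$. 1. If $c<1/2$ and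 $\mu$ is the law of a centered, translation invariant (not necessarily circular) complex Gaussian process on $\mathbb Z^d$, $d\ge 1$, then $\psi\in X_{1/2-c}$ for $\mu$-almost every $\psi$. 2. If $c<1/4$, $d=1$ and $\mu$ is a microcanonical measure of the infinite DNLS, for some densities $\rho_E,\rho_N\in\mathbb R$, then $\psi\in X_{1/2-c}$ for $\mu$-almost every $\psi$. 3. If $c<1/4$, $d=1$ and $\mu$ is a grand canonical Gibbs measure of the infinite DNLS, for some $\beta>0$ and $\kappa\in\mathbb R$, then $\psi\in X_{1/2-c}$ for $\mu$-almost every $\psi$. -/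

import Mathlib

open MeasureTheory Filter Topology

noncomputable section

namespace DNLS

/-- The lattice `ℤ^d`. -/
abbrev Lattice (d : ℕ) : Type := Fin d → ℤ

/-- The configuration space `ℂ^(ℤ^d)`, with the product topology and product σ-algebra. -/
abbrev Field (d : ℕ) : Type := Lattice d → ℂ

/-- The periodic box `Λ_L = {-L, …, L}^d` with addition modulo `2L+1`. A class in
`ZMod (2L+1)` is identified with its representative in `{-L, …, L}` (`ZMod.valMinAbs`). -/
abbrev Box (d L : ℕ) : Type := Fin d → ZMod (2 * L + 1)

/-- The configuration space `ℂ^(Λ_L)` of the finite system. -/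
abbrev BoxField (d L : ℕ) : Type := Box d L → ℂ

/-- The embedding of `Λ_L` into `ℤ^d` with image `{-L, …, L}^d`. -/
def Box.toLattice {d L : ℕ} (x : Box d L) : Lattice d := fun i => (x i).valMinAbs

/-- The reduction `ℤ^d → Λ_L` modulo `2L+1`. -/
def Lattice.toBox {d : ℕ} (L : ℕ) (x : Lattice d) : Box d L := fun i => (x i : ZMod (2 * L + 1))

/-- The periodic extension of a configuration on `Λ_L` to all of `ℤ^d`. -/
def periodicExtension {d L : ℕ} (ψ : BoxField d L) : Field d := fun x => ψ (x.toBox L)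

/-- The regularized absolute value `⟨x⟩ = (1 + |x|²)^(1/2)`, with the Euclidean `|x|`. -/
def bracket {d : ℕ} (x : Lattice d) : ℝ := Real.sqrt (1 + ∑ i, (x i : ℝ) ^ 2)

/-- The space `X_p` of power law bounded sequences: `sup_x ⟨x⟩^(-p) |ψ(x)| < ∞`. -/
def powerLawSpace (d : ℕ) (p : ℝ) : Set (Field d) :=
  {ψ | BddAbove (Set.range fun x : Lattice d => bracket x ^ (-p) * ‖ψ x‖)}

/-- The translation of configurations by `a`. -/
def translate {d : ℕ} (a : Lattice d) (ψ : Field d) : Field d := fun x => ψ (x + a)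

/-- Translation invariance of a measure on `ℂ^(ℤ^d)`. -/
def IsTranslationInvariant {d : ℕ} (μ : Measure (Field d)) : Prop :=
  ∀ a : Lattice d, μ.map (translate a) = μ

/-- The measure `μ` on `ℂ^(ℤ^d)` is (the law of) a centered translation invariant complex valued
Gaussian process: all finite families of the real and imaginary parts of the `ψ(x)` are jointly
Gaussian (no circular symmetry is required, and degenerate Gaussians are allowed). -/
structure IsCenteredInvariantGaussian {d : ℕ} (μ : Measure (Field d)) : Prop where
  gaussian : ProbabilityTheory.IsGaussianProcess (fun (x : Lattice d) (ψ : Field d) => ψ x) μ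
  centered : ∀ x : Lattice d, ∫ ψ, ψ x ∂μ = 0
  invariant : IsTranslationInvariant μ

/-- A hopping potential: symmetric and of finite range. -/
structure IsHoppingPotential {d : ℕ} (α : Lattice d → ℝ) : Prop where
  symmetric : ∀ x, α (-x) = α x
  finiteRange : (Function.support α).Finite

/-- The energy
`H_L(ψ) = ∑_{x,y ∈ Λ_L} α_L(x-y) ψ(x) ψ(y)^* + (lam/2) ∑_{x ∈ Λ_L} |ψ(x)|⁴`,
where `x - y` is taken in the periodic box and `α_L` is the restriction of `α` to `Λ_L`.
For symmetric `α` the first sum is real, so taking its real part only changes its type. -/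
def energy {d : ℕ} (α : Lattice d → ℝ) (lam : ℝ) {L : ℕ} (ψ : BoxField d L) : ℝ :=
  (∑ x : Box d L, ∑ y : Box d L,
      (α (x - y).toLattice : ℂ) * ψ x * (starRingEnd ℂ) (ψ y)).re
    + lam / 2 * ∑ x : Box d L, ‖ψ x‖ ^ 4

/-- The particle number `N_L(ψ) = ∑_{x ∈ Λ_L} |ψ(x)|²`. -/
def particleNumber {d L : ℕ} (ψ : BoxField d L) : ℝ := ∑ x : Box d L, ‖ψ x‖ ^ 2

/-- The volume `(2L+1)^d` of the box. -/
def boxVolume (d L : ℕ) : ℝ := (2 * (L : ℝ) + 1) ^ d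

/-- The thin shell around the joint level set `H_L = ρE (2L+1)^d`, `N_L = ρN (2L+1)^d`, of
width `a` in energy and width `b` in particle number. -/
def shell {d : ℕ} (α : Lattice d → ℝ) (lam ρE ρN : ℝ) (L : ℕ) (a b : ℝ) : Set (BoxField d L) :=
  {ψ | |energy α lam ψ - ρE * boxVolume d L| ≤ a ∧
    |particleNumber ψ - ρN * boxVolume d L| ≤ b}

/-- `m` is a microcanonical measure of the finite system, that is
`Z⁻¹ δ(H_L - ρE (2L+1)^d) δ(N_L - ρN (2L+1)^d) ∏ dRe ψ(x) dIm ψ(x)`.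
The normalized product of the Dirac deltas is read in the usual way, as a weak limit of the
normalized Lebesgue measures on shells around the joint level set, as the two widths tend to `0`.
The two widths may tend to `0` in any manner, and every weak limit that arises counts. If the
joint limit exists, it is the only such measure. -/
def IsFiniteMicrocanonical {d : ℕ} (α : Lattice d → ℝ) (lam ρE ρN : ℝ) (L : ℕ)
    (m : Measure (BoxField d L)) : Prop :=
  IsProbabilityMeasure m ∧
  ∃ a b : ℕ → ℝ, (∀ k, 0 < a k) ∧ (∀ k, 0 < b k) ∧
    Tendsto a atTop (𝓝 0) ∧ Tendsto b atTop (𝓝 0) ∧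
    ∀ f : BoundedContinuousFunction (BoxField d L) ℝ,
      Tendsto
        (fun k => ∫ ψ, f ψ ∂(ProbabilityTheory.cond volume (shell α lam ρE ρN L (a k) (b k))))
        atTop (𝓝 (∫ ψ, f ψ ∂m))

/-- The density `exp(-β (H_L(ψ) - κ N_L(ψ)))` with inverse temperature `β` and chemical
potential `κ`. -/
def gibbsDensity {d : ℕ} (α : Lattice d → ℝ) (lam β κ : ℝ) {L : ℕ} (ψ : BoxField d L) : ENNReal :=
  ENNReal.ofReal (Real.exp (-β * (energy α lam ψ - κ * particleNumber ψ)))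

/-- The grand canonical Gibbs measure of the finite system,
`Z⁻¹ exp(-β (H_L - κ N_L)) ∏ dRe ψ(x) dIm ψ(x)`. -/
def finiteGibbs {d : ℕ} (α : Lattice d → ℝ) (lam β κ : ℝ) (L : ℕ) : Measure (BoxField d L) :=
  (∫⁻ ψ : BoxField d L, gibbsDensity α lam β κ ψ)⁻¹ •
    (volume : Measure (BoxField d L)).withDensity (gibbsDensity α lam β κ)

/-- The measures `m k` on `ℂ^(Λ_{L k})`, transported to `ℂ^(ℤ^d)` by periodic extension, converge
weakly to `μ` while the box sizes `L k` tend to infinity. -/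
def IsInfiniteVolumeLimit {d : ℕ} (L : ℕ → ℕ) (m : ∀ k, Measure (BoxField d (L k)))
    (μ : Measure (Field d)) : Prop :=
  Tendsto L atTop atTop ∧
  ∀ f : BoundedContinuousFunction (Field d) ℝ,
    Tendsto (fun k => ∫ ψ, f (periodicExtension ψ) ∂(m k)) atTop (𝓝 (∫ ψ, f ψ ∂μ))

/-- `μ` is a microcanonical measure of the infinite system with energy density `ρE` and particle
density `ρN`: a probability measure that is an infinite volume limit, possibly along a
subsequence of boxes, of microcanonical measures of the finite systems. -/
def IsMicrocanonical {d : ℕ} (α : Lattice d → ℝ) (lam ρE ρN : ℝ) (μ : Measure (Field d)) : Prop :=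
  IsProbabilityMeasure μ ∧
  ∃ (L : ℕ → ℕ) (m : ∀ k, Measure (BoxField d (L k))),
    (∀ k, IsFiniteMicrocanonical α lam ρE ρN (L k) (m k)) ∧ IsInfiniteVolumeLimit L m μ

/-- `μ` is a grand canonical Gibbs measure of the infinite system: a probability measure that is
an infinite volume limit, possibly along a subsequence of boxes, of the Gibbs measures of the
finite systems. -/
def IsGrandCanonical {d : ℕ} (α : Lattice d → ℝ) (lam β κ : ℝ) (μ : Measure (Field d)) : Prop :=
  IsProbabilityMeasure μ ∧
  ∃ L : ℕ → ℕ, IsInfiniteVolumeLimit L (fun k => finiteGibbs α lam β κ (L k)) μ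

end DNLS

end

namespace DNLS

/-! ### From uniform moment bounds to almost sure power law bounds. -/

section PowerLaw

variable {d : ℕ}

/-! If the moments of order `k` of the field are bounded uniformly in the site and `p * k > d`, then
the sum of `⟨x⟩^(-pk) |ψ(x)|^k` over the lattice has finite expectation. It is therefore finite
almost surely, and each of its terms bounds `(⟨x⟩^(-p) |ψ(x)|)^k` (`ae_mem_powerLawSpace`).

An invariant Gaussian field has finite moments of every order, the same at all sites, so every `p >
0` is reached. For the DNLS measures with `d = 1`, fourth moments suffice: `4 * (1/2 - c) > 1`
exactly when `c < 1/4`.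

The fourth moments come from the defocusing sign `lam > 0`. By `abs_energy_sub_le` the hopping
energy is at most a constant times the particle number, so energy and particle number control the
quartic sum. On a microcanonical shell that sum is at most a constant times the volume. Under the
Gibbs measure, comparison with independent sites bounds its exponential moment by `r ^ n` on `n`
sites (`lintegral_exp_finiteGibbs_le`), so its mean is also of the order of the volume. Translation
invariance turns this into a bound at each site, independent of `L`, and truncation carries it to
the weak limit (`lintegral_le_of_tendsto_integral`). -/

lemma one_le_bracket (x : Lattice d) : 1 ≤ bracket x := by
  rw [bracket, Real.one_le_sqrt]
  have : 0 ≤ ∑ i, (x i : ℝ) ^ 2 := Finset.sum_nonneg fun i _ => sq_nonneg _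
  linarith

lemma bracket_pos (x : Lattice d) : 0 < bracket x := one_pos.trans_le (one_le_bracket x)

/-- A product of one-variable summable functions is summable on the lattice. -/
lemma summable_prod_apply {β : Type*} {f : β → ℝ} (hf : Summable f) (h0 : ∀ n, 0 ≤ f n) :
    Summable fun x : Fin d → β => ∏ i, f (x i) := by
  classical
  refine summable_of_sum_le (c := (∑' n, f n) ^ d)
    (fun x => Finset.prod_nonneg fun i _ => h0 _) fun s => ?_
  have hsub : s ⊆ Fintype.piFinset fun i => s.image fun x => x i := fun x hx => by
    simp only [Fintype.mem_piFinset, Finset.mem_image]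
    exact fun i => ⟨x, hx, rfl⟩
  calc ∑ x ∈ s, ∏ i, f (x i)
      ≤ ∑ x ∈ Fintype.piFinset fun i => s.image fun x => x i, ∏ i, f (x i) :=
        Finset.sum_le_sum_of_subset_of_nonneg hsub
          fun x _ _ => Finset.prod_nonneg fun i _ => h0 _
    _ = ∏ i : Fin d, ∑ n ∈ s.image (fun x => x i), f n := (Finset.prod_univ_sum _ _).symm
    _ ≤ ∏ _i : Fin d, ∑' n, f n :=
        Finset.prod_le_prod (fun i _ => Finset.sum_nonneg fun n _ => h0 n)
          fun i _ => hf.sum_le_tsum _ fun n _ => h0 n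
    _ = (∑' n, f n) ^ d := by simp

lemma summable_one_add_sq_rpow {s : ℝ} (hs : 1 < s) :
    Summable fun n : ℤ => (1 + (n : ℝ) ^ 2) ^ (-s / 2) := by
  refine Summable.of_norm_bounded_eventually (Real.summable_abs_int_rpow hs) ?_
  filter_upwards [(Set.finite_singleton (0 : ℤ)).compl_mem_cofinite] with n hn
  have hn0 : (n : ℝ) ≠ 0 := by exact_mod_cast hn
  have hpos : 0 < (n : ℝ) ^ 2 := by positivity
  rw [Real.norm_of_nonneg (by positivity)]
  calc (1 + (n : ℝ) ^ 2) ^ (-s / 2) ≤ ((n : ℝ) ^ 2) ^ (-s / 2) :=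
        Real.rpow_le_rpow_of_nonpos hpos (by linarith) (by linarith)
    _ = |(n : ℝ)| ^ (-s) := by
        rw [← sq_abs, ← Real.rpow_natCast, ← Real.rpow_mul (abs_nonneg _)]
        congr 1
        push_cast
        ring

/-- The powers of the regularized absolute value are summable below the critical exponent. -/
lemma summable_bracket_rpow {s : ℝ} (hs : (d : ℝ) < s) :
    Summable fun x : Lattice d => bracket x ^ (-s) := by
  -- The exponent is split as `s / d > 1` per coordinate, so `d = 0`, where the lattice is a point,
  -- is set apart.
  rcases Nat.eq_zero_or_pos d with rfl | hd
  · exact Summable.of_finite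
  have hd' : (0 : ℝ) < d := by exact_mod_cast hd
  refine Summable.of_nonneg_of_le (fun x => (Real.rpow_pos_of_pos (bracket_pos x) _).le) ?_
    (summable_prod_apply (d := d) (summable_one_add_sq_rpow (s := s / d) ((one_lt_div hd').2 hs))
      fun n => by positivity)
  intro x
  have key : ∀ i, bracket x ^ (-(s / d)) ≤ (1 + (x i : ℝ) ^ 2) ^ (-(s / d) / 2) := by
    intro i
    have h1 : (1 + (x i : ℝ) ^ 2) ≤ 1 + ∑ j, (x j : ℝ) ^ 2 := by
      gcongr
      exact Finset.single_le_sum (f := fun j => (x j : ℝ) ^ 2) (fun j _ => sq_nonneg _)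
        (Finset.mem_univ i)
    rw [bracket, Real.sqrt_eq_rpow, ← Real.rpow_mul (by positivity)]
    rw [show (1 / 2 : ℝ) * -(s / d) = -(s / d) / 2 by ring]
    have : 0 < s / d := div_pos (hd'.trans hs) hd'
    exact Real.rpow_le_rpow_of_nonpos (by positivity) h1 (by linarith)
  calc bracket x ^ (-s) = ∏ _i : Fin d, bracket x ^ (-(s / d)) := by
        rw [Finset.prod_const, Finset.card_univ, Fintype.card_fin, ← Real.rpow_natCast,
          ← Real.rpow_mul (bracket_pos x).le]
        congr 1
        field_simp
    _ ≤ _ := Finset.prod_le_prod (fun i _ => (Real.rpow_pos_of_pos (bracket_pos x) _).le)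
        fun i _ => key i

/-- A uniform bound on the moments of order `k` forces power law bounds of any order
`p > d / k`, almost surely. -/
lemma ae_mem_powerLawSpace {μ : Measure (Field d)} {p : ℝ} {k : ℕ} (hk : k ≠ 0)
    (hp : (d : ℝ) < p * k) {C : ℝ}
    (hC : ∀ x, ∫⁻ ψ, ENNReal.ofReal (‖ψ x‖ ^ k) ∂μ ≤ ENNReal.ofReal C) :
    ∀ᵐ ψ ∂μ, ψ ∈ powerLawSpace d p := by
  set w : Lattice d → ℝ := fun x => bracket x ^ (-(p * k))
  have hw0 : ∀ x, 0 ≤ w x := fun x => (Real.rpow_pos_of_pos (bracket_pos x) _).le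
  have hw : Summable w := summable_bracket_rpow hp
  have hmeas : ∀ x, Measurable fun ψ : Field d =>
      ENNReal.ofReal (w x) * ENNReal.ofReal (‖ψ x‖ ^ k) := fun x =>
    Measurable.const_mul (by fun_prop) _
  have hfin : ∫⁻ ψ, ∑' x, ENNReal.ofReal (w x) * ENNReal.ofReal (‖ψ x‖ ^ k) ∂μ ≠ ⊤ := by
    rw [lintegral_tsum fun x => (hmeas x).aemeasurable]
    refine ne_top_of_le_ne_top (b := ∑' x, ENNReal.ofReal (w x) * ENNReal.ofReal C) ?_ ?_
    · rw [ENNReal.tsum_mul_right, ← ENNReal.ofReal_tsum_of_nonneg hw0 hw]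
      exact ENNReal.mul_ne_top ENNReal.ofReal_ne_top ENNReal.ofReal_ne_top
    · refine ENNReal.tsum_le_tsum fun x => ?_
      rw [lintegral_const_mul _ (by fun_prop)]
      gcongr
      exact hC x
  filter_upwards [ae_lt_top' (AEMeasurable.tsum fun x => (hmeas x).aemeasurable) hfin] with ψ hψ
  set S := ∑' x, ENNReal.ofReal (w x) * ENNReal.ofReal (‖ψ x‖ ^ k)
  -- Since `b ≤ b ^ k` once `b ≥ 1`, the bound `1 + S` avoids a `k`-th root.
  refine ⟨1 + S.toReal, ?_⟩
  rintro _ ⟨x, rfl⟩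
  set b := bracket x ^ (-p) * ‖ψ x‖
  have hb0 : 0 ≤ b := mul_nonneg (Real.rpow_pos_of_pos (bracket_pos x) _).le (norm_nonneg _)
  have hbk : b ^ k = w x * ‖ψ x‖ ^ k := by
    rw [mul_pow, ← Real.rpow_natCast (bracket x ^ (-p)), ← Real.rpow_mul (bracket_pos x).le]
    congr 2
    ring
  have hle : b ^ k ≤ S.toReal := by
    rw [← ENNReal.ofReal_le_iff_le_toReal hψ.ne, hbk, ENNReal.ofReal_mul (hw0 x)]
    exact ENNReal.le_tsum x
  change b ≤ 1 + S.toReal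
  rcases le_total b 1 with h | h
  · linarith [ENNReal.toReal_nonneg (a := S)]
  · linarith [le_self_pow₀ h hk]

end PowerLaw

/-! ### Gaussian fields. -/

section Gaussian

variable {d : ℕ}

lemma measurable_translate (a : Lattice d) : Measurable (translate a) :=
  measurable_pi_lambda _ fun x => measurable_pi_apply (x + a)

/-- Gaussian variables have moments of all orders, so `k` can be taken larger than `d / p`;
invariance reduces every site to the origin. -/
lemma IsCenteredInvariantGaussian.ae_mem_powerLawSpace {μ : Measure (Field d)}
    (h : IsCenteredInvariantGaussian μ) {p : ℝ} (hp : 0 < p) :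
    ∀ᵐ ψ ∂μ, ψ ∈ powerLawSpace d p := by
  obtain ⟨n, hn⟩ := exists_nat_gt (d / p)
  have hk : (d : ℝ) < p * (n + 1 : ℕ) := by
    rw [div_lt_iff₀ hp] at hn
    push_cast
    nlinarith
  refine DNLS.ae_mem_powerLawSpace (k := n + 1) n.succ_ne_zero hk
    (C := (∫⁻ ψ, ENNReal.ofReal (‖ψ 0‖ ^ (n + 1)) ∂μ).toReal) fun x => ?_
  have hmem : MemLp (fun ψ : Field d => ψ 0) ((n + 1 : ℕ) : ENNReal) μ :=
    (h.gaussian.hasGaussianLaw_eval 0).memLp (ENNReal.natCast_ne_top _)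
  have hint := (hmem.integrable_norm_pow n.succ_ne_zero).lintegral_lt_top
  rw [ENNReal.ofReal_toReal hint.ne]
  conv_rhs => rw [← h.invariant x]
  rw [lintegral_map (by fun_prop) (measurable_translate x)]
  simp [translate]

end Gaussian

/-! ### Moment bounds under weak limits. -/

section WeakLimit

/-- Moment bounds pass to weak limits. -/
lemma lintegral_le_of_tendsto_integral {X : Type*} [TopologicalSpace X] [MeasurableSpace X]
    [BorelSpace X] {m : ℕ → Measure X} [∀ k, IsFiniteMeasure (m k)] {μ : Measure X}
    [IsFiniteMeasure μ]
    (h : ∀ f : BoundedContinuousFunction X ℝ,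
      Tendsto (fun k => ∫ x, f x ∂(m k)) atTop (𝓝 (∫ x, f x ∂μ)))
    {g : X → ℝ} (hg : Continuous g) (hg0 : ∀ x, 0 ≤ g x) {C : ℕ → ℝ} {C' : ℝ}
    (hC0 : ∀ k, 0 ≤ C k) (hC : Tendsto C atTop (𝓝 C'))
    (hm : ∀ k, ∫⁻ x, ENNReal.ofReal (g x) ∂(m k) ≤ ENNReal.ofReal (C k)) :
    ∫⁻ x, ENNReal.ofReal (g x) ∂μ ≤ ENNReal.ofReal C' := by
  -- The truncation of `g` at `n` is an admissible test function; monotone convergence then removes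
  -- it.
  have htrunc : ∀ n : ℕ, ∫⁻ x, ENNReal.ofReal (min (g x) n) ∂μ ≤ ENNReal.ofReal C' := by
    intro n
    let f : BoundedContinuousFunction X ℝ :=
      BoundedContinuousFunction.ofNormedAddCommGroup (fun x => min (g x) n)
        (hg.min continuous_const) n fun x => by
          rw [Real.norm_of_nonneg (le_min (hg0 x) n.cast_nonneg)]
          exact min_le_right _ _
    have hf0 : ∀ x, 0 ≤ f x := fun x => le_min (hg0 x) n.cast_nonneg
    have hf : ∀ x, f x ≤ g x := fun x => min_le_left _ _
    have hle : ∫ x, f x ∂μ ≤ C' := by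
      refine le_of_tendsto_of_tendsto' (h f) hC fun k => ?_
      rw [integral_eq_lintegral_of_nonneg_ae (ae_of_all _ hf0)
        f.continuous.aestronglyMeasurable]
      refine ENNReal.toReal_le_of_le_ofReal (hC0 k) (le_trans ?_ (hm k))
      exact lintegral_mono fun x => ENNReal.ofReal_le_ofReal (hf x)
    change ∫⁻ x, ENNReal.ofReal (f x) ∂μ ≤ _
    rw [← ofReal_integral_eq_lintegral_ofReal (f.integrable μ) (ae_of_all _ hf0)]
    exact ENNReal.ofReal_le_ofReal hle
  refine le_of_tendsto' (lintegral_tendsto_of_tendsto_of_monotone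
    (f := fun (n : ℕ) x => ENNReal.ofReal (min (g x) n)) (fun n => ?_) ?_ ?_) htrunc
  · exact (hg.min continuous_const).measurable.ennreal_ofReal.aemeasurable
  · exact ae_of_all _ fun _ a b hab => ENNReal.ofReal_le_ofReal <|
      min_le_min le_rfl (by exact_mod_cast hab)
  · refine ae_of_all _ fun x => tendsto_const_nhds.congr' ?_
    filter_upwards [eventually_ge_atTop ⌈g x⌉₊] with n hn
    rw [min_eq_left (Nat.ceil_le.1 hn)]

lemma continuous_periodicExtension {d L : ℕ} :
    Continuous (periodicExtension : BoxField d L → Field d) :=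
  continuous_pi fun _ => continuous_apply _

/-- The class of `x` in the box depends on `k`, hence the uniformity over sites in `hm`. -/
lemma IsInfiniteVolumeLimit.lintegral_le {d : ℕ} {L : ℕ → ℕ} {m : ∀ k, Measure (BoxField d (L k))}
    {μ : Measure (Field d)} (h : IsInfiniteVolumeLimit L m μ) [∀ k, IsFiniteMeasure (m k)]
    [IsFiniteMeasure μ] {C : ℝ} (hC0 : 0 ≤ C)
    (hm : ∀ k x, ∫⁻ ψ, ENNReal.ofReal (‖ψ x‖ ^ 4) ∂(m k) ≤ ENNReal.ofReal C) (x : Lattice d) :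
    ∫⁻ ψ, ENNReal.ofReal (‖ψ x‖ ^ 4) ∂μ ≤ ENNReal.ofReal C := by
  refine lintegral_le_of_tendsto_integral (m := fun k => (m k).map periodicExtension)
    (fun f => ?_) (g := fun ψ => ‖ψ x‖ ^ 4) (by fun_prop) (fun ψ => by positivity)
    (fun _ => hC0) (tendsto_const_nhds (x := C)) fun k => ?_
  · refine (h.2 f).congr fun k => ?_
    rw [integral_map continuous_periodicExtension.measurable.aemeasurable
      f.continuous.aestronglyMeasurable]
  · rw [lintegral_map (by fun_prop) continuous_periodicExtension.measurable]
    exact hm k _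

end WeakLimit

variable {d L : ℕ}

/-! ### Translation invariance on the periodic box. -/

section Translation

/-- The translation of configurations on the periodic box. -/
def boxTranslate (a : Box d L) (ψ : BoxField d L) : BoxField d L := fun x => ψ (x + a)

/-- A translation permutes the coordinates, and Lebesgue measure is a product of equal factors. -/
lemma measurePreserving_boxTranslate (a : Box d L) :
    MeasurePreserving (boxTranslate a : BoxField d L → BoxField d L) volume volume := by
  convert volume_measurePreserving_piCongrLeft (fun _ : Box d L => ℂ) (Equiv.addRight a).symm
    using 1
  ext ψ x
  have := Equiv.piCongrLeft_apply_apply (fun _ : Box d L => ℂ) (Equiv.addRight a).symm ψ (x + a)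
  simpa [boxTranslate, MeasurableEquiv.coe_piCongrLeft] using this.symm

lemma sum_boxTranslate {M : Type*} [AddCommMonoid M] (g : ℂ → M) (a : Box d L)
    (ψ : BoxField d L) : ∑ x, g (boxTranslate a ψ x) = ∑ x, g (ψ x) :=
  Fintype.sum_equiv (Equiv.addRight a) _ _ fun _ => rfl

lemma energy_boxTranslate (α : Lattice d → ℝ) (lam : ℝ) (a : Box d L) (ψ : BoxField d L) :
    energy α lam (boxTranslate a ψ) = energy α lam ψ := by
  unfold energy
  rw [sum_boxTranslate (fun z => ‖z‖ ^ 4)]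
  congr 2
  refine Fintype.sum_equiv (Equiv.addRight a) _ _ fun x => ?_
  refine Fintype.sum_equiv (Equiv.addRight a) _ _ fun y => ?_
  simp [boxTranslate]

lemma particleNumber_boxTranslate (a : Box d L) (ψ : BoxField d L) :
    particleNumber (boxTranslate a ψ) = particleNumber ψ :=
  sum_boxTranslate (fun z => ‖z‖ ^ 2) a ψ

lemma card_box : (Fintype.card (Box d L) : ℝ) = boxVolume d L := by
  simp [boxVolume, ZMod.card]

lemma one_le_boxVolume : 1 ≤ boxVolume d L :=
  one_le_pow₀ (by linarith [L.cast_nonneg (α := ℝ)])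

/-- For a translation invariant measure, a bound on the total quartic moment that is proportional
to the volume is a bound on the quartic moment at each site. -/
lemma lintegral_norm_pow_le_of_sum {m : Measure (BoxField d L)}
    (hinv : ∀ a, MeasurePreserving (boxTranslate a) m m) {C : ℝ}
    (h : ∫⁻ ψ, ENNReal.ofReal (∑ x, ‖ψ x‖ ^ 4) ∂m ≤ ENNReal.ofReal (C * boxVolume d L))
    (x : Box d L) : ∫⁻ ψ, ENNReal.ofReal (‖ψ x‖ ^ 4) ∂m ≤ ENNReal.ofReal C := by
  have hsite : ∀ y : Box d L, ∫⁻ ψ, ENNReal.ofReal (‖ψ y‖ ^ 4) ∂m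
      = ∫⁻ ψ, ENNReal.ofReal (‖ψ x‖ ^ 4) ∂m := fun y => by
    rw [← (hinv (y - x)).lintegral_comp (f := fun ψ => ENNReal.ofReal (‖ψ x‖ ^ 4)) (by fun_prop)]
    simp [boxTranslate]
  have hsum : ∫⁻ ψ, ENNReal.ofReal (∑ x, ‖ψ x‖ ^ 4) ∂m
      = ENNReal.ofReal (boxVolume d L) * ∫⁻ ψ, ENNReal.ofReal (‖ψ x‖ ^ 4) ∂m := by
    simp_rw [ENNReal.ofReal_sum_of_nonneg fun (x : Box d L) _ =>
      pow_nonneg (norm_nonneg _) 4]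
    rw [lintegral_finsetSum _ fun y _ => by fun_prop]
    simp_rw [hsite]
    rw [Finset.sum_const, nsmul_eq_mul, Finset.card_univ, ← card_box, ENNReal.ofReal_natCast]
  have hV : 0 < boxVolume d L := one_pos.trans_le one_le_boxVolume
  rw [hsum, mul_comm C, ENNReal.ofReal_mul hV.le] at h
  exact (ENNReal.mul_le_mul_iff_right (by simpa using hV) ENNReal.ofReal_ne_top).1 h

end Translation

/-! ### Control of the hopping energy. -/

section Energy

lemma toLattice_injective : Function.Injective (Box.toLattice : Box d L → Lattice d) :=
  fun _ _ h => funext fun i => ZMod.injective_valMinAbs (congrFun h i)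

/-- The right side does not depend on `L`, which makes all later constants uniform in the volume. -/
lemma sum_abs_toLattice_le {α : Lattice d → ℝ} (hα : (Function.support α).Finite) :
    ∑ z : Box d L, |α z.toLattice| ≤ ∑' x, |α x| := by
  have hs : Summable fun x => |α x| :=
    (summable_of_hasFiniteSupport hα).abs
  rw [← tsum_fintype (L := .unconditional _)]
  exact tsum_comp_le_tsum_of_inj hs (fun _ => abs_nonneg _) toLattice_injective

/-- The hopping energy is controlled by the particle number. -/
lemma abs_energy_sub_le {α : Lattice d → ℝ} (hα : (Function.support α).Finite) (lam : ℝ)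
    (ψ : BoxField d L) :
    |energy α lam ψ - lam / 2 * ∑ x, ‖ψ x‖ ^ 4| ≤ (∑' x, |α x|) * particleNumber ψ := by
  rw [energy, add_sub_cancel_right]
  set A := ∑' x, |α x|
  refine (Complex.abs_re_le_norm _).trans ?_
  -- Young's inequality; the row and column sums of the kernel are then bounded as in Schur's test.
  have hterm : ∀ x y : Box d L, ‖(α (x - y).toLattice : ℂ) * ψ x * (starRingEnd ℂ) (ψ y)‖
      ≤ |α (x - y).toLattice| * ‖ψ x‖ ^ 2 / 2 + |α (x - y).toLattice| * ‖ψ y‖ ^ 2 / 2 := by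
    intro x y
    rw [norm_mul, norm_mul, RCLike.norm_conj, Complex.norm_real, Real.norm_eq_abs]
    nlinarith [mul_nonneg (abs_nonneg (α (x - y).toLattice)) (sq_nonneg (‖ψ x‖ - ‖ψ y‖))]
  have hrow : ∀ x : Box d L, ∑ y : Box d L, |α (x - y).toLattice| ≤ A := fun x =>
    (Fintype.sum_equiv (Equiv.subLeft x) _ (fun z : Box d L => |α z.toLattice|)
      fun _ => rfl).trans_le (sum_abs_toLattice_le hα)
  have hcol : ∀ y : Box d L, ∑ x : Box d L, |α (x - y).toLattice| ≤ A := fun y =>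
    (Fintype.sum_equiv (Equiv.subRight y) _ (fun z : Box d L => |α z.toLattice|)
      fun _ => rfl).trans_le (sum_abs_toLattice_le hα)
  have h1 : ∑ x : Box d L, ∑ y : Box d L, |α (x - y).toLattice| * ‖ψ x‖ ^ 2 / 2
      ≤ A * particleNumber ψ / 2 := by
    rw [particleNumber, Finset.mul_sum, Finset.sum_div]
    refine Finset.sum_le_sum fun x _ => ?_
    rw [← Finset.sum_div, ← Finset.sum_mul]
    gcongr
    exact hrow x
  have h2 : ∑ x : Box d L, ∑ y : Box d L, |α (x - y).toLattice| * ‖ψ y‖ ^ 2 / 2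
      ≤ A * particleNumber ψ / 2 := by
    rw [Finset.sum_comm, particleNumber, Finset.mul_sum, Finset.sum_div]
    refine Finset.sum_le_sum fun y _ => ?_
    rw [← Finset.sum_div, ← Finset.sum_mul]
    gcongr
    exact hcol y
  calc _ ≤ ∑ x : Box d L, ∑ y : Box d L, (|α (x - y).toLattice| * ‖ψ x‖ ^ 2 / 2
          + |α (x - y).toLattice| * ‖ψ y‖ ^ 2 / 2) :=
        (norm_sum_le _ _).trans <| Finset.sum_le_sum fun x _ =>
          (norm_sum_le _ _).trans <| Finset.sum_le_sum fun y _ => hterm x y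
    _ ≤ A * particleNumber ψ := by
        simp_rw [Finset.sum_add_distrib]
        linarith

lemma particleNumber_nonneg (ψ : BoxField d L) : 0 ≤ particleNumber ψ :=
  Finset.sum_nonneg fun _ _ => by positivity

lemma continuous_particleNumber : Continuous (particleNumber : BoxField d L → ℝ) := by
  unfold particleNumber
  fun_prop

lemma continuous_energy (α : Lattice d → ℝ) (lam : ℝ) :
    Continuous (energy α lam : BoxField d L → ℝ) := by
  unfold energy
  exact (Complex.continuous_re.comp (by fun_prop)).add (by fun_prop)

end Energy

/-! ### Quartic moments of microcanonical measures. -/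

section Microcanonical

lemma measurableSet_shell (α : Lattice d → ℝ) (lam ρE ρN a b : ℝ) :
    MeasurableSet (shell α lam ρE ρN L a b) :=
  ((isClosed_le ((continuous_energy α lam).sub continuous_const).abs continuous_const).inter
    (isClosed_le (continuous_particleNumber.sub continuous_const).abs
      continuous_const)).measurableSet

lemma measurePreserving_cond_shell (α : Lattice d → ℝ) (lam ρE ρN a b : ℝ) (v : Box d L) :
    MeasurePreserving (boxTranslate v)
      (ProbabilityTheory.cond volume (shell α lam ρE ρN L a b))
      (ProbabilityTheory.cond volume (shell α lam ρE ρN L a b)) := by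
  have hpre : boxTranslate v ⁻¹' shell α lam ρE ρN L a b = shell α lam ρE ρN L a b := by
    ext ψ
    simp [shell, energy_boxTranslate, particleNumber_boxTranslate]
  have h := (measurePreserving_boxTranslate v).restrict_preimage
    (measurableSet_shell α lam ρE ρN a b)
  rw [hpre] at h
  exact h.smul_measure _

/-- The quartic sum is bounded proportionally to the volume on every shell. -/
lemma sum_norm_pow_le_of_mem_shell {α : Lattice d → ℝ} (hα : (Function.support α).Finite)
    {lam : ℝ} (hlam : 0 < lam) {ρE ρN a b : ℝ} (ha : 0 < a) (hb : 0 < b) {ψ : BoxField d L}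
    (hψ : ψ ∈ shell α lam ρE ρN L a b) :
    ∑ x, ‖ψ x‖ ^ 4
      ≤ 2 / lam * (|ρE| + a + (∑' x, |α x|) * (|ρN| + b)) * boxVolume d L := by
  obtain ⟨hE, hN⟩ := hψ
  have hA : 0 ≤ ∑' x, |α x| := tsum_nonneg fun _ => abs_nonneg _
  have hV := one_le_boxVolume (d := d) (L := L)
  set V := boxVolume d L
  set A := ∑' x, |α x|
  -- The widths are absorbed into multiples of `V` because `1 ≤ V`.
  have hE' : energy α lam ψ ≤ (|ρE| + a) * V := by
    nlinarith [le_abs_self ρE, (abs_le.1 hE).2]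
  have hN' : particleNumber ψ ≤ (|ρN| + b) * V := by
    nlinarith [le_abs_self ρN, (abs_le.1 hN).2]
  have hH := (abs_le.1 (abs_energy_sub_le hα lam ψ)).1
  have hAN := mul_le_mul_of_nonneg_left hN' hA
  rw [mul_assoc, div_mul_eq_mul_div, le_div_iff₀ hlam]
  nlinarith

lemma IsFiniteMicrocanonical.lintegral_le {α : Lattice d → ℝ} (hα : (Function.support α).Finite)
    {lam : ℝ} (hlam : 0 < lam) {ρE ρN : ℝ} {m : Measure (BoxField d L)}
    (hm : IsFiniteMicrocanonical α lam ρE ρN L m) (x : Box d L) :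
    ∫⁻ ψ, ENNReal.ofReal (‖ψ x‖ ^ 4) ∂m
      ≤ ENNReal.ofReal (2 / lam * (|ρE| + (∑' x, |α x|) * |ρN|)) := by
  obtain ⟨hprob, a, b, ha, hb, ha0, hb0, hlim⟩ := hm
  have hA : 0 ≤ ∑' x, |α x| := tsum_nonneg fun _ => abs_nonneg _
  set A := ∑' x, |α x|
  have hC0 : ∀ k, 0 ≤ 2 / lam * (|ρE| + a k + A * (|ρN| + b k)) := fun k => by
    have := ha k
    have := hb k
    positivity
  -- The constants depend on `k` through the shell widths, which vanish in the limit.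
  refine lintegral_le_of_tendsto_integral hlim (g := fun ψ => ‖ψ x‖ ^ 4) (by fun_prop)
    (fun ψ => by positivity) (C := fun k => 2 / lam * (|ρE| + a k + A * (|ρN| + b k))) hC0 ?_
    fun k => ?_
  · simpa using ((ha0.const_add |ρE|).add ((hb0.const_add |ρN|).const_mul A)).const_mul (2 / lam)
  · refine lintegral_norm_pow_le_of_sum
      (fun v => measurePreserving_cond_shell α lam ρE ρN (a k) (b k) v) ?_ x
    refine (lintegral_mono_ae (g := fun _ => ENNReal.ofReal
      (2 / lam * (|ρE| + a k + A * (|ρN| + b k)) * boxVolume d L)) ?_).trans ?_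
    · filter_upwards [ProbabilityTheory.ae_cond_mem (μ := volume)
        (measurableSet_shell α lam ρE ρN (L := L) (a k) (b k))] with ψ hψ
      exact ENNReal.ofReal_le_ofReal (sum_norm_pow_le_of_mem_shell hα hlam (ha k) (hb k) hψ)
    · rw [lintegral_const]
      -- Mass at most one is enough; the conditioned measure is zero when the shell is null.
      exact mul_le_of_le_one_right' prob_le_one

end Microcanonical

/-! ### Quartic moments of Gibbs measures. -/

section Gibbs

lemma measurable_gibbsDensity (α : Lattice d → ℝ) (lam β κ : ℝ) :
    Measurable (gibbsDensity α lam β κ : BoxField d L → ENNReal) := by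
  unfold gibbsDensity
  have h1 := (continuous_energy (L := L) α lam).measurable
  have h2 := (continuous_particleNumber (d := d) (L := L)).measurable
  fun_prop

lemma measurePreserving_finiteGibbs (α : Lattice d → ℝ) (lam β κ : ℝ) (v : Box d L) :
    MeasurePreserving (boxTranslate v) (finiteGibbs α lam β κ L) (finiteGibbs α lam β κ L) := by
  refine MeasurePreserving.smul_measure ?_ _
  have hT := measurePreserving_boxTranslate v
  refine ⟨hT.measurable, Measure.ext fun s hs => ?_⟩
  rw [Measure.map_apply hT.measurable hs, withDensity_apply _ hs,
    withDensity_apply _ (hT.measurable hs),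
    ← hT.setLIntegral_comp_preimage hs (measurable_gibbsDensity α lam β κ)]
  simp [gibbsDensity, energy_boxTranslate, particleNumber_boxTranslate]

/-- The one-site weight `exp(b|z|² - g|z|⁴)`. -/
noncomputable def siteWeight (b g : ℝ) (z : ℂ) : ℝ := Real.exp (b * ‖z‖ ^ 2 - g * ‖z‖ ^ 4)

lemma integrable_siteWeight (b : ℝ) {g : ℝ} (hg : 0 < g) : Integrable (siteWeight b g) := by
  have hint : Integrable fun z : ℂ => Real.exp (-1 * ‖z‖ ^ 2) := by
    have := (GaussianFourier.integrable_cexp_neg_mul_sq_norm_add (V := ℂ) (b := 1)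
      (by simp) 0 0).norm
    refine this.congr (ae_of_all _ fun z => ?_)
    simp only [Complex.norm_exp]
    norm_cast
    simp
  refine (hint.const_mul (Real.exp ((b + 1) ^ 2 / (4 * g)))).mono'
    (by unfold siteWeight; fun_prop) (ae_of_all _ fun z => ?_)
  rw [siteWeight, Real.norm_of_nonneg (Real.exp_pos _).le, ← Real.exp_add, Real.exp_le_exp]
  -- Completing the square in `‖z‖ ^ 2` gives domination by a Gaussian.
  have : (b + 1) ^ 2 / (4 * g) - (b + 1) * ‖z‖ ^ 2 + g * ‖z‖ ^ 4
      = (2 * g * ‖z‖ ^ 2 - (b + 1)) ^ 2 / (4 * g) := by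
    field_simp
    ring
  have h0 : 0 ≤ (2 * g * ‖z‖ ^ 2 - (b + 1)) ^ 2 / (4 * g) := by positivity
  linarith

lemma integral_siteWeight_pos (b : ℝ) {g : ℝ} (hg : 0 < g) : 0 < ∫ z, siteWeight b g z :=
  integral_exp_pos (integrable_siteWeight b hg)

lemma prod_siteWeight (b g : ℝ) (ψ : BoxField d L) :
    ∏ x, siteWeight b g (ψ x)
      = Real.exp (b * particleNumber ψ - g * ∑ x, ‖ψ x‖ ^ 4) := by
  simp only [siteWeight, ← Real.exp_sum, Finset.sum_sub_distrib, ← Finset.mul_sum, particleNumber]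

/-- The partition function of independent sites factorizes. -/
lemma lintegral_exp_site (b : ℝ) {g : ℝ} (hg : 0 < g) :
    ∫⁻ ψ : BoxField d L, ENNReal.ofReal
        (Real.exp (b * particleNumber ψ - g * ∑ x, ‖ψ x‖ ^ 4))
      = ENNReal.ofReal ((∫ z, siteWeight b g z) ^ Fintype.card (Box d L)) := by
  simp_rw [← prod_siteWeight]
  rw [← integral_fintype_prod_volume_eq_pow, ofReal_integral_eq_lintegral_ofReal]
  · exact Integrable.fintype_prod fun _ => integrable_siteWeight b hg
  · exact ae_of_all _ fun ψ => Finset.prod_nonneg fun x _ => (Real.exp_pos _).le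

/-- This holds whatever the value of the partition function in `[0, ∞]`, and is all that the moment
bound needs of the normalization. -/
lemma finiteGibbs_univ_le_one (α : Lattice d → ℝ) (lam β κ : ℝ) :
    finiteGibbs α lam β κ L Set.univ ≤ 1 := by
  rw [finiteGibbs, Measure.smul_apply, withDensity_apply _ MeasurableSet.univ,
    Measure.restrict_univ, smul_eq_mul]
  exact ENNReal.inv_mul_le_one _

instance isFiniteMeasure_finiteGibbs (α : Lattice d → ℝ) (lam β κ : ℝ) :
    IsFiniteMeasure (finiteGibbs α lam β κ L) :=
  ⟨(finiteGibbs_univ_le_one α lam β κ).trans_lt ENNReal.one_lt_top⟩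

/-- Both sides are needed: the upper bound for the weighted integral in the numerator, the lower
bound for the partition function. Each compares with independent sites. -/
lemma gibbs_bounds {α : Lattice d → ℝ} (hα : (Function.support α).Finite) (lam : ℝ) {β : ℝ}
    (hβ : 0 < β) (κ : ℝ) (ψ : BoxField d L) :
    |-β * (energy α lam ψ - κ * particleNumber ψ) + β * lam / 2 * ∑ x, ‖ψ x‖ ^ 4|
      ≤ β * ((∑' x, |α x|) + |κ|) * particleNumber ψ := by
  have h := abs_energy_sub_le hα lam ψ
  have hN := particleNumber_nonneg ψ
  have hκ : |κ * particleNumber ψ| = |κ| * particleNumber ψ := by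
    rw [abs_mul, abs_of_nonneg hN]
  rw [show -β * (energy α lam ψ - κ * particleNumber ψ) + β * lam / 2 * ∑ x, ‖ψ x‖ ^ 4
    = -β * ((energy α lam ψ - lam / 2 * ∑ x, ‖ψ x‖ ^ 4) - κ * particleNumber ψ) by ring,
    abs_mul, abs_neg, abs_of_pos hβ, mul_assoc, add_mul, ← hκ]
  gcongr
  exact (abs_sub _ _).trans (by gcongr)

/-- The constant in the bound on the quartic moments of the Gibbs measures. -/
noncomputable def gibbsRatio (b g : ℝ) : ℝ := (∫ z, siteWeight b g z) / ∫ z, siteWeight (-b) (2 * g) z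

lemma one_le_gibbsRatio {b g : ℝ} (hb : 0 ≤ b) (hg : 0 < g) : 1 ≤ gibbsRatio b g := by
  rw [gibbsRatio, one_le_div (integral_siteWeight_pos _ (by linarith))]
  refine integral_mono (integrable_siteWeight _ (by linarith)) (integrable_siteWeight _ hg)
    fun z => Real.exp_le_exp.2 ?_
  have h1 : 0 ≤ b * ‖z‖ ^ 2 := by positivity
  have h2 : 0 ≤ g * ‖z‖ ^ 4 := by positivity
  linarith

/-- Exponential moments of the quartic sum grow at most exponentially with the volume. -/
lemma lintegral_exp_finiteGibbs_le {α : Lattice d → ℝ} (hα : (Function.support α).Finite)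
    {lam : ℝ} (hlam : 0 < lam) {β : ℝ} (hβ : 0 < β) (κ : ℝ) :
    ∫⁻ ψ, ENNReal.ofReal (Real.exp (β * lam / 4 * ∑ x, ‖ψ x‖ ^ 4)) ∂(finiteGibbs α lam β κ L)
      ≤ ENNReal.ofReal
        (gibbsRatio (β * ((∑' x, |α x|) + |κ|)) (β * lam / 4) ^ Fintype.card (Box d L)) := by
  set b := β * ((∑' x, |α x|) + |κ|) with hb
  -- The Gibbs exponent contains `-2 * g` times the quartic sum, so an exponential moment of rate
  -- `g` leaves half of it for integrability.
  set g := β * lam / 4 with hg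
  have hg0 : 0 < g := by positivity
  have hbd := fun ψ : BoxField d L => abs_le.1 (gibbs_bounds hα lam hβ κ ψ)
  simp only [← hb, show β * lam / 2 = 2 * g by rw [hg]; ring] at hbd
  have hZ : ENNReal.ofReal ((∫ z, siteWeight (-b) (2 * g) z) ^ Fintype.card (Box d L))
      ≤ ∫⁻ ψ : BoxField d L, gibbsDensity α lam β κ ψ := by
    rw [← lintegral_exp_site _ (by linarith)]
    refine lintegral_mono fun ψ => ENNReal.ofReal_le_ofReal (Real.exp_le_exp.2 ?_)
    linarith [(hbd ψ).1]
  have hnum : ∫⁻ ψ : BoxField d L, gibbsDensity α lam β κ ψ *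
        ENNReal.ofReal (Real.exp (g * ∑ x, ‖ψ x‖ ^ 4))
      ≤ ENNReal.ofReal ((∫ z, siteWeight b g z) ^ Fintype.card (Box d L)) := by
    rw [← lintegral_exp_site _ hg0]
    refine lintegral_mono fun ψ => ?_
    rw [gibbsDensity, ← ENNReal.ofReal_mul (Real.exp_pos _).le, ← Real.exp_add]
    refine ENNReal.ofReal_le_ofReal (Real.exp_le_exp.2 ?_)
    linarith [(hbd ψ).2]
  have hpos : 0 < (∫ z, siteWeight (-b) (2 * g) z) ^ Fintype.card (Box d L) :=
    pow_pos (integral_siteWeight_pos _ (by linarith)) _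
  rw [finiteGibbs, lintegral_smul_measure, smul_eq_mul,
    lintegral_withDensity_eq_lintegral_mul _ (measurable_gibbsDensity α lam β κ) (by fun_prop),
    gibbsRatio, div_pow, div_eq_inv_mul, ENNReal.ofReal_mul (inv_nonneg.2 hpos.le),
    ENNReal.ofReal_inv_of_pos hpos]
  exact mul_le_mul' (ENNReal.inv_le_inv.2 hZ) hnum

lemma lintegral_finiteGibbs_le {α : Lattice d → ℝ} (hα : (Function.support α).Finite)
    {lam : ℝ} (hlam : 0 < lam) {β : ℝ} (hβ : 0 < β) (κ : ℝ) (x : Box d L) :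
    ∫⁻ ψ, ENNReal.ofReal (‖ψ x‖ ^ 4) ∂(finiteGibbs α lam β κ L)
      ≤ ENNReal.ofReal ((β * lam / 4)⁻¹ *
        (Real.log (gibbsRatio (β * ((∑' x, |α x|) + |κ|)) (β * lam / 4)) + 1)) := by
  refine lintegral_norm_pow_le_of_sum (measurePreserving_finiteGibbs α lam β κ) ?_ x
  have hexp := lintegral_exp_finiteGibbs_le (L := L) hα hlam hβ κ
  have hA : 0 ≤ ∑' x, |α x| := tsum_nonneg fun _ => abs_nonneg _
  have hr := one_le_gibbsRatio (b := β * ((∑' x, |α x|) + |κ|)) (g := β * lam / 4)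
    (by positivity) (by positivity)
  set r := gibbsRatio (β * ((∑' x, |α x|) + |κ|)) (β * lam / 4)
  set g := β * lam / 4 with hg
  have hg0 : 0 < g := by positivity
  set n := Fintype.card (Box d L)
  have hr0 : 0 < r := by linarith
  have hlog : 0 ≤ Real.log r := Real.log_nonneg hr
  have hV := one_le_boxVolume (d := d) (L := L)
  -- The inequality `1 + u ≤ exp u` at `u = g * S - n * log r`, with `S` the quartic sum, plays the
  -- role of Jensen's inequality: the shift by `n * log r` makes the mean of `exp u` at most one.
  have hpt : ∀ ψ : BoxField d L, ENNReal.ofReal (∑ x, ‖ψ x‖ ^ 4)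
      ≤ ENNReal.ofReal (g⁻¹ * (n * Real.log r)) + ENNReal.ofReal (g⁻¹ * (r ^ n)⁻¹) *
        ENNReal.ofReal (Real.exp (g * ∑ x, ‖ψ x‖ ^ 4)) := by
    intro ψ
    rw [← ENNReal.ofReal_mul (by positivity), ← ENNReal.ofReal_add (by positivity) (by positivity)]
    refine ENNReal.ofReal_le_ofReal ?_
    have h := Real.add_one_le_exp (g * ∑ x, ‖ψ x‖ ^ 4 - n * Real.log r)
    rw [Real.exp_sub, Real.exp_nat_mul, Real.exp_log hr0, div_eq_inv_mul] at h
    rw [mul_assoc, ← mul_add, le_inv_mul_iff₀ hg0]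
    linarith
  calc ∫⁻ ψ, ENNReal.ofReal (∑ x, ‖ψ x‖ ^ 4) ∂(finiteGibbs α lam β κ L)
      ≤ ∫⁻ ψ, (ENNReal.ofReal (g⁻¹ * (n * Real.log r)) + ENNReal.ofReal (g⁻¹ * (r ^ n)⁻¹) *
        ENNReal.ofReal (Real.exp (g * ∑ x, ‖ψ x‖ ^ 4))) ∂(finiteGibbs α lam β κ L) :=
        lintegral_mono hpt
    _ ≤ ENNReal.ofReal (g⁻¹ * (n * Real.log r)) + ENNReal.ofReal (g⁻¹ * (r ^ n)⁻¹) *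
          ENNReal.ofReal (r ^ n) := by
        rw [lintegral_add_left measurable_const, lintegral_const,
          lintegral_const_mul _ (by fun_prop)]
        gcongr
        exact mul_le_of_le_one_right' (finiteGibbs_univ_le_one α lam β κ)
    _ = ENNReal.ofReal (g⁻¹ * (n * Real.log r) + g⁻¹) := by
        rw [← ENNReal.ofReal_mul (by positivity),
          ← ENNReal.ofReal_add (by positivity) (by positivity), mul_assoc,
          inv_mul_cancel₀ (by positivity), mul_one]
    _ ≤ ENNReal.ofReal (g⁻¹ * (Real.log r + 1) * boxVolume d L) := by
        -- The leftover `g⁻¹` is absorbed using that the volume is at least one.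
        refine ENNReal.ofReal_le_ofReal ?_
        rw [card_box, mul_assoc]
        have : g⁻¹ ≤ g⁻¹ * boxVolume d L := le_mul_of_one_le_right (by positivity) hV
        linarith

end Gibbs

end DNLS

theorem theorem2 (c : ℝ) (hc : 0 < c) :
    (c < 1 / 2 → ∀ (d : ℕ) (μ : Measure (DNLS.Field d)),
      DNLS.IsCenteredInvariantGaussian μ →
        ∀ᵐ ψ ∂μ, ψ ∈ DNLS.powerLawSpace d (1 / 2 - c)) ∧
    (c < 1 / 4 → ∀ (α : DNLS.Lattice 1 → ℝ) (lam : ℝ),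
      DNLS.IsHoppingPotential α → 0 < lam →
        (∀ (ρE ρN : ℝ) (μ : Measure (DNLS.Field 1)),
          DNLS.IsMicrocanonical α lam ρE ρN μ →
            ∀ᵐ ψ ∂μ, ψ ∈ DNLS.powerLawSpace 1 (1 / 2 - c)) ∧
        (∀ (β κ : ℝ) (μ : Measure (DNLS.Field 1)), 0 < β →
          DNLS.IsGrandCanonical α lam β κ μ →
            ∀ᵐ ψ ∂μ, ψ ∈ DNLS.powerLawSpace 1 (1 / 2 - c))) := by
  refine ⟨fun hc2 d μ hμ => hμ.ae_mem_powerLawSpace (by linarith),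
    fun hc4 α lam hα hlam => ⟨fun ρE ρN μ hμ => ?_, fun β κ μ hβ hμ => ?_⟩⟩
  · obtain ⟨_, L, m, hm, hlim⟩ := hμ
    have := fun k => (hm k).1
    have hA : 0 ≤ ∑' x, |α x| := tsum_nonneg fun _ => abs_nonneg _
    exact DNLS.ae_mem_powerLawSpace four_ne_zero (by push_cast; linarith)
      (hlim.lintegral_le (by positivity) fun k => (hm k).lintegral_le hα.finiteRange hlam)
  · obtain ⟨_, L, hlim⟩ := hμ
    have hA : 0 ≤ ∑' x, |α x| := tsum_nonneg fun _ => abs_nonneg _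
    have hr := Real.log_nonneg (DNLS.one_le_gibbsRatio (b := β * ((∑' x, |α x|) + |κ|))
      (g := β * lam / 4) (by positivity) (by positivity))
    exact DNLS.ae_mem_powerLawSpace four_ne_zero (by push_cast; linarith)
      (hlim.lintegral_le (by positivity)
        fun k => DNLS.lintegral_finiteGibbs_le hα.finiteRange hlam hβ κ)
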